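/- For every $\epsilon>0$ there is a constant $c>0$, depending only on $\epsilon$, such that for every integer $N\ge 0$, every bounded open set $\Omega\subset\mathbb R^3$ and every magnetic potential $A\in L^2_{\rm loc}(\mathbb R^3;\mathbb R^3)$ with $\operatorname{div}A=0$ in the sense of distributions, one has $$\sum_{i=1}^N\Big(T(A)_{x_i}+\epsilon\max_{k\ne i}|x_i-x_k|^{-1}\Big)\;\ge\; c\,N\min\Big\{\frac{N}{|\Omega|},\Big(\frac{N}{|\Omega|}\Big)^{1/3}\Big\}$$ as self-adjoint operators (equivalently, as quadratic forms) on the complex Hilbert space $L^2(\Omega^N)$, without any symmetry requirement on the wave functions. Here $T(A)=(-i\nabla+A(x))^2$ is the magnetic Laplacian with Dirichlet boundary conditions on $\Omega$, $T(A)_{x_i}$ is its copy acting on the variable $x_i\in\Omega$, the maximum over the empty set (case $N=1$) is $0$, and $|\Omega|$ is the Lebesgue measure of $\Omega$. The operator on the left is the self-adjoint operator associated with the closed quadratic form $$q(\psi)=\sum_{i=1}^N\int_{\Omega^N}\big|(-i\nabla_{x_i}+A(x_i))\psi\big|^2\,dx+\epsilon\int_{\Omega^N}\sum_{i=1}^N\max_{k\ne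 i}|x_i-x_k|^{-1}\,|\psi|^2\,dx ,$$ defined for those $\psi$ with finite potential energy in the closure of $C_c^\infty(\Omega^N;\mathbb C)$ for the norm $\big(\|\psi\|^2+\sum_i\|(-i\nabla_{x_i}+A(x_i))\psi\|^2\big)^{1/2}$. The inequality means $q(\psi)\ge cN\min\{N/|\Omega|,(N/|\Omega|)^{1/3}\}\|\psi\|^2$ for all $\psi$ in this form domain, and in particular $\langle\psi,H\psi\rangle\ge cN\min\{\dots\}\|\psi\|^2$ for all $\psi$ in the domain of the operator $H$ on the left. -/

import Mathlib

open MeasureTheory Filter Topology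
open scoped ContDiff

noncomputable section

namespace RepellingParticles

/-- Physical space `ℝ³`, with the Euclidean norm and Lebesgue measure. -/
abbrev Space : Type := EuclideanSpace ℝ (Fin 3)

/-- Configurations `(x₁, …, x_N)` of `N` particles, with Lebesgue measure. -/
abbrev Config (N : ℕ) : Type := Fin N → Space

/-- The product domain `Ω^N`. -/
def domainPow (Ω : Set Space) (N : ℕ) : Set (Config N) := {x | ∀ i, x i ∈ Ω}

/-- The complex Hilbert space `L²(Ω^N)`. -/
abbrev HilbertN (Ω : Set Space) (N : ℕ) : Type :=
  Lp ℂ 2 ((volume : Measure (Config N)).restrict (domainPow Ω N))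

/-- `A ∈ L²_loc(ℝ³; ℝ³)`. -/
def LocallyL2 (A : Space → Space) : Prop :=
  ∀ K : Set Space, IsCompact K → MemLp A 2 (volume.restrict K)

/-- `div A = 0` in the sense of distributions on `ℝ³`. -/
def DivFree (A : Space → Space) : Prop :=
  ∀ η : Space → ℝ, ContDiff ℝ ∞ η → HasCompactSupport η →
    ∫ x, fderiv ℝ η x (A x) = 0

/-- `φ ∈ C_c^∞(Ω^N; ℂ)`, extended by zero to all configurations. -/
structure IsTestFunction (Ω : Set Space) (N : ℕ) (φ : Config N → ℂ) : Prop where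
  smooth : ContDiff ℝ ∞ φ
  compact : HasCompactSupport φ
  support : tsupport φ ⊆ domainPow Ω N

/-- The `a`-th component of the magnetic momentum of the `i`-th particle,
`(-i ∂_{x_{i,a}} + A_a(x_i)) φ`. -/
def magneticMomentum {N : ℕ} (A : Space → Space) (i : Fin N) (a : Fin 3)
    (φ : Config N → ℂ) (x : Config N) : ℂ :=
  -Complex.I * fderiv ℝ φ x (Pi.single i (EuclideanSpace.single a (1 : ℝ)))
    + ((A (x i) a : ℝ) : ℂ) * φ x

/-- All pairs `(φ, (-i∇ + A) φ)` in `L²` with `φ ∈ C_c^∞(Ω^N)`. -/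
def smoothMagneticGraph (A : Space → Space) (Ω : Set Space) (N : ℕ) :
    Set (HilbertN Ω N × (Fin N → Fin 3 → HilbertN Ω N)) :=
  {p | ∃ φ : Config N → ℂ, IsTestFunction Ω N φ ∧
    (p.1 : Config N → ℂ) =ᵐ[volume.restrict (domainPow Ω N)] φ ∧
    ∀ i a, (p.2 i a : Config N → ℂ) =ᵐ[volume.restrict (domainPow Ω N)]
      magneticMomentum A i a φ}

/-- `ψ` lies in the form domain of the magnetic Laplacian with Dirichlet boundary conditions on
`Ω^N` (the closure of `C_c^∞(Ω^N)` in the form norm) and `G i a` are the components of its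
magnetic gradient. -/
def HasDirichletMagneticGradient (A : Space → Space) (Ω : Set Space) (N : ℕ)
    (ψ : HilbertN Ω N) (G : Fin N → Fin 3 → HilbertN Ω N) : Prop :=
  (ψ, G) ∈ closure (smoothMagneticGraph A Ω N)

/-- `max_{k ≠ i} |x_i - x_k|⁻¹`; it is `0` if there is no other particle. (On the Lebesgue null
set of configurations where two positions coincide the value is immaterial.) -/
def maxRepulsion {N : ℕ} (x : Config N) (i : Fin N) : ℝ :=
  ⨆ k : {k : Fin N // k ≠ i}, ‖x i - x k.1‖⁻¹

/-- The multiplication operator `∑_i ε max_{k ≠ i} |x_i - x_k|⁻¹`. -/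
def potential {N : ℕ} (ε : ℝ) (x : Config N) : ℝ := ∑ i, ε * maxRepulsion x i

/-- `ψ` is in the form domain of `H = ∑_i (T(A)_{x_i} + ε max_{k ≠ i} |x_i - x_k|⁻¹)`,
where `T(A) = (-i∇ + A)²` has Dirichlet boundary conditions on `Ω`,
and `G` is the magnetic gradient of `ψ`. -/
structure InFormDomain (ε : ℝ) (A : Space → Space) (Ω : Set Space) (N : ℕ)
    (ψ : HilbertN Ω N) (G : Fin N → Fin 3 → HilbertN Ω N) : Prop where
  gradient : HasDirichletMagneticGradient A Ω N ψ G
  finite_potential : Integrable (fun x => potential ε x * ‖ψ x‖ ^ 2)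
    (volume.restrict (domainPow Ω N))

/-- The sesquilinear form of `H` evaluated at `(φ, ψ)`, where `F` and `G` are the magnetic
gradients of `φ` and `ψ`:
`∑_{i,a} ⟨F_{i,a}, G_{i,a}⟩ + ∫ (∑_i ε max_{k ≠ i} |x_i - x_k|⁻¹) conj(φ) ψ`. -/
def energyForm (ε : ℝ) (Ω : Set Space) (N : ℕ)
    (φ : HilbertN Ω N) (F : Fin N → Fin 3 → HilbertN Ω N)
    (ψ : HilbertN Ω N) (G : Fin N → Fin 3 → HilbertN Ω N) : ℂ :=
  ∑ i, ∑ a, inner ℂ (F i a) (G i a)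
    + ∫ x in domainPow Ω N, (potential ε x : ℂ) * inner ℂ (φ x) (ψ x)

/-- `ψ ∈ D(H)` and `H ψ = f`, where `H = ∑_i (T(A)_{x_i} + ε max_{k ≠ i} |x_i - x_k|⁻¹)` is the
self-adjoint operator on `L²(Ω^N)` associated with the closed form `energyForm`
(its Friedrichs realization). -/
def IsHamiltonianValue (ε : ℝ) (A : Space → Space) (Ω : Set Space) (N : ℕ)
    (ψ f : HilbertN Ω N) : Prop :=
  ∃ G, InFormDomain ε A Ω N ψ G ∧
    ∀ φ F, InFormDomain ε A Ω N φ F → energyForm ε Ω N φ F ψ G = inner ℂ φ f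

end RepellingParticles

end

namespace RepellingParticles

/-! Cut space into cubes whose side `l` is of order `(N/|Ω|)^{-1/3}`, and call a cube sparse if `Ω`
fills at most half of it. Every particle is then in one of three situations.

In a sparse cube the wave function vanishes on at least half of the cube, so a Poincaré inequality
makes its kinetic energy pay at least `1/(64 l²)`. The diamagnetic inequality reduces this to the
non-magnetic case, with a bound independent of `A` (`setLIntegral_sparse_sq_le_magnetic`). A
particle that shares its cube with another one is within distance `2l` of it and pays `ε/(2l)` in
repulsion (`inv_le_maxRepulsion`). Only a particle alone in a dense cube may pay nothing; such
particles occupy distinct cubes, each containing more than `l³/2` of `Ω`, so there are at most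
`2|Ω|/l³ ≤ N/2` of them (`card_alone_mul_le`).

Hence at least half of the particles pay the smaller of the two amounts. With `l = 2/t`, `t =
(N/|Ω|)^{1/3}`, these are `t²/256` and `εt/4`, both at least a constant times `min (t³, t)`. -/

/-! ### Poincaré inequality on convex sets -/

theorem sq_setLIntegral_unitInterval_le {f : ℝ → ENNReal} (hf : Measurable f) :
    (∫⁻ t in Set.Icc (0 : ℝ) 1, f t) ^ 2 ≤ ∫⁻ t in Set.Icc (0 : ℝ) 1, f t ^ 2 := by
  have h := ENNReal.lintegral_mul_le_Lp_mul_Lq (volume.restrict (Set.Icc (0 : ℝ) 1))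
    Real.HolderConjugate.two_two hf.aemeasurable (aemeasurable_const (b := (1 : ENNReal)))
  simp only [Pi.mul_apply, mul_one, lintegral_const,
    Measure.restrict_apply_univ, Real.volume_Icc, sub_zero, ENNReal.ofReal_one,
    ENNReal.rpow_two, one_pow, ENNReal.one_rpow] at h
  calc _ ≤ ((∫⁻ t in Set.Icc (0 : ℝ) 1, f t ^ 2) ^ (1 / 2 : ℝ)) ^ 2 := by gcongr
    _ = _ := by rw [← ENNReal.rpow_two, ← ENNReal.rpow_mul]; norm_num

theorem lintegral_comp_smul_add_le {F : Space → ENNReal} (hF : Measurable F) {t : ℝ}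
    (ht : 1 / 2 ≤ t) (v : Space) : ∫⁻ x, F (t • x + v) ≤ 8 * ∫⁻ x, F x := by
  have ht0 : 0 < t := by linarith
  have h1 : ∫⁻ x, F (t • x + v) = ∫⁻ x, F (x + v) ∂(Measure.map (fun x : Space => t • x) volume) :=
    (lintegral_map (hF.comp (measurable_id.add_const v)) (measurable_const_smul t)).symm
  rw [h1, Measure.map_addHaar_smul _ ht0.ne', lintegral_smul_measure, lintegral_add_right_eq_self,
    smul_eq_mul]
  gcongr
  rw [finrank_euclideanSpace_fin, abs_of_pos (by positivity)]
  refine ENNReal.ofReal_le_of_le_toReal ?_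
  rw [ENNReal.toReal_ofNat]
  calc (t ^ 3)⁻¹ ≤ ((1 / 2 : ℝ) ^ 3)⁻¹ := by gcongr
    _ = 8 := by norm_num

/-- Fundamental theorem of calculus along the segment from `y` to `x`, then Cauchy–Schwarz in `t`.
-/
theorem enorm_sub_sq_le_lintegral_segment {h : Space → ℝ} (hh : ContDiff ℝ 1 h) {d : ℝ}
    {x y : Space} (hd : dist x y ≤ d) :
    ‖h x - h y‖ₑ ^ 2 ≤ ENNReal.ofReal d ^ 2 *
      ∫⁻ t in Set.Icc (0 : ℝ) 1, ‖fderiv ℝ h (t • x + (1 - t) • y)‖ₑ ^ 2 := by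
  have hc : Continuous fun t : ℝ => fderiv ℝ h (t • x + (1 - t) • y) :=
    (hh.continuous_fderiv one_ne_zero).comp (by fun_prop)
  have hder : ∀ t : ℝ, HasDerivAt (fun t : ℝ => h (t • x + (1 - t) • y))
      (fderiv ℝ h (t • x + (1 - t) • y) (x - y)) t := by
    intro t
    have h1 : HasDerivAt (fun t : ℝ => t • x + (1 - t) • y) (x - y) t := by
      have := ((hasDerivAt_id t).smul_const x).add
        (((hasDerivAt_id t).const_sub 1).smul_const y)
      exact HasDerivAt.congr_deriv this (by simp [sub_eq_add_neg])
    exact ((hh.differentiable one_ne_zero _).hasFDerivAt).comp_hasDerivAt t h1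
  have hint := intervalIntegral.integral_eq_sub_of_hasDerivAt (a := 0) (b := 1)
    (fun t _ => hder t) ((hc.clm_apply continuous_const).intervalIntegrable 0 1)
  simp only [one_smul, sub_self, zero_smul, add_zero, sub_zero, zero_add] at hint
  rw [← hint, intervalIntegral.integral_of_le zero_le_one, ← integral_Icc_eq_integral_Ioc]
  have hxy : ‖x - y‖ₑ ≤ ENNReal.ofReal d := by
    rw [← ofReal_norm, ← dist_eq_norm]; exact ENNReal.ofReal_le_ofReal hd
  have hm : Measurable fun t : ℝ => ‖fderiv ℝ h (t • x + (1 - t) • y)‖ₑ := hc.enorm.measurable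
  calc _ ≤ (∫⁻ t in Set.Icc (0 : ℝ) 1, ‖fderiv ℝ h (t • x + (1 - t) • y) (x - y)‖ₑ) ^ 2 := by
        gcongr; exact enorm_integral_le_lintegral_enorm _
    _ ≤ (∫⁻ t in Set.Icc (0 : ℝ) 1,
          ENNReal.ofReal d * ‖fderiv ℝ h (t • x + (1 - t) • y)‖ₑ) ^ 2 := by
        gcongr with t
        rw [mul_comm]
        exact (ContinuousLinearMap.le_opENorm _ _).trans (by gcongr)
    _ = ENNReal.ofReal d ^ 2 *
          (∫⁻ t in Set.Icc (0 : ℝ) 1, ‖fderiv ℝ h (t • x + (1 - t) • y)‖ₑ) ^ 2 := by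
        rw [lintegral_const_mul _ hm, mul_pow]
    _ ≤ _ := by gcongr; exact sq_setLIntegral_unitInterval_le hm

/-- One of `t`, `1 - t` is at least `1/2`. Integrating first in the variable that carries this
weight is a change of variables with Jacobian factor at most `2³ = 8`, and convexity keeps the image
inside `Q`. -/
theorem lintegral_convexCombination_le {F : Space → ENNReal} (hF : Measurable F) {Q : Set Space}
    (hQ : Convex ℝ Q) (hQm : MeasurableSet Q) {t : ℝ} (ht : t ∈ Set.Icc (0 : ℝ) 1) :
    ∫⁻ x in Q, ∫⁻ y in Q, F (t • x + (1 - t) • y) ≤ 8 * volume Q * ∫⁻ z in Q, F z := by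
  have key : ∀ s : ℝ, 1 / 2 ≤ s → s ≤ 1 → ∀ y ∈ Q,
      ∫⁻ x in Q, F (s • x + (1 - s) • y) ≤ 8 * ∫⁻ z in Q, F z := by
    intro s hs hs1 y hy
    calc ∫⁻ x in Q, F (s • x + (1 - s) • y)
        ≤ ∫⁻ x in Q, Q.indicator F (s • x + (1 - s) • y) := by
          refine setLIntegral_mono' hQm fun x hx => ?_
          rw [Set.indicator_of_mem (hQ hx hy (by linarith) (by linarith) (by ring))]
      _ ≤ ∫⁻ x, Q.indicator F (s • x + (1 - s) • y) := setLIntegral_le_lintegral _ _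
      _ ≤ 8 * ∫⁻ x, Q.indicator F x := lintegral_comp_smul_add_le (hF.indicator hQm) hs _
      _ = _ := by rw [lintegral_indicator hQm]
  have hconst : ∀ f : Space → ENNReal, (∀ y ∈ Q, f y ≤ 8 * ∫⁻ z in Q, F z) →
      ∫⁻ y in Q, f y ≤ 8 * volume Q * ∫⁻ z in Q, F z := by
    intro f hf
    refine (setLIntegral_mono' hQm hf).trans_eq ?_
    rw [setLIntegral_const]; ring
  rcases le_total (1 / 2) t with h | h
  · rw [lintegral_lintegral_swap]
    · exact hconst _ fun y hy => key t h ht.2 y hy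
    · exact (hF.comp (by fun_prop)).aemeasurable
  · refine hconst _ fun x hx => ?_
    have := key (1 - t) (by linarith) (by linarith [ht.1]) x hx
    simpa only [sub_sub_cancel, add_comm] using this

/-- A Poincaré inequality on a convex set, in double integral form. -/
theorem lintegral_lintegral_sub_sq_le {h : Space → ℝ} (hh : ContDiff ℝ 1 h) {Q : Set Space}
    (hQ : Convex ℝ Q) (hQm : MeasurableSet Q) {d : ℝ} (hd : ∀ x ∈ Q, ∀ y ∈ Q, dist x y ≤ d) :
    ∫⁻ x in Q, ∫⁻ y in Q, ‖h x - h y‖ₑ ^ 2 ≤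
      ENNReal.ofReal d ^ 2 * (8 * volume Q * ∫⁻ z in Q, ‖fderiv ℝ h z‖ₑ ^ 2) := by
  have hc : Continuous fun z => ‖fderiv ℝ h z‖ₑ ^ 2 :=
    (ENNReal.continuous_pow 2).comp (hh.continuous_fderiv one_ne_zero).enorm
  set F : Space → ENNReal := fun z => ‖fderiv ℝ h z‖ₑ ^ 2 with hF
  have hm : Measurable fun p : (Space × Space) × ℝ => F (p.2 • p.1.1 + (1 - p.2) • p.1.2) :=
    hc.measurable.comp (by fun_prop)
  calc ∫⁻ x in Q, ∫⁻ y in Q, ‖h x - h y‖ₑ ^ 2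
      ≤ ∫⁻ x in Q, ∫⁻ y in Q, ENNReal.ofReal d ^ 2 *
          ∫⁻ t in Set.Icc (0 : ℝ) 1, F (t • x + (1 - t) • y) :=
        setLIntegral_mono' hQm fun x hx => setLIntegral_mono' hQm fun y hy =>
          enorm_sub_sq_le_lintegral_segment hh (hd x hx y hy)
    _ = ENNReal.ofReal d ^ 2 * ∫⁻ x in Q, ∫⁻ y in Q,
          ∫⁻ t in Set.Icc (0 : ℝ) 1, F (t • x + (1 - t) • y) := by
        rw [← lintegral_const_mul' _ _ (by finiteness)]
        refine lintegral_congr fun x => ?_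
        rw [lintegral_const_mul' _ _ (by finiteness)]
    _ = ENNReal.ofReal d ^ 2 * ∫⁻ t in Set.Icc (0 : ℝ) 1, ∫⁻ x in Q, ∫⁻ y in Q,
          F (t • x + (1 - t) • y) := by
        congr 1
        calc _ = ∫⁻ x in Q, ∫⁻ t in Set.Icc (0 : ℝ) 1, ∫⁻ y in Q, F (t • x + (1 - t) • y) := by
              refine lintegral_congr fun x => lintegral_lintegral_swap ?_
              exact (hm.comp (f := fun q : Space × ℝ => ((x, q.1), q.2)) (by fun_prop)).aemeasurable
          _ = _ := by
              refine lintegral_lintegral_swap (Measurable.aemeasurable ?_)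
              exact Measurable.lintegral_prod_right' (ν := volume.restrict Q)
                (hm.comp (f := fun q : (Space × ℝ) × Space => ((q.1.1, q.2), q.1.2)) (by fun_prop))
    _ ≤ ENNReal.ofReal d ^ 2 * ∫⁻ _ in Set.Icc (0 : ℝ) 1, 8 * volume Q * ∫⁻ z in Q, F z := by
        refine mul_le_mul_right ?_ _
        exact setLIntegral_mono' measurableSet_Icc fun t ht =>
          lintegral_convexCombination_le hc.measurable hQ hQm ht
    _ = _ := by simp

/-- A Poincaré inequality for functions that vanish on at least half of a convex set. -/
theorem setLIntegral_sq_le_of_vanishing {h : Space → ℝ} (hh : ContDiff ℝ 1 h) {Q Z : Set Space}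
    (hQ : Convex ℝ Q) (hQm : MeasurableSet Q) {d : ℝ} (hd : ∀ x ∈ Q, ∀ y ∈ Q, dist x y ≤ d)
    (hQ0 : volume Q ≠ 0) (hQt : volume Q ≠ ⊤) (hZ : MeasurableSet Z) (hZQ : Z ⊆ Q)
    (hvol : volume Q ≤ 2 * volume Z) (hzero : ∀ z ∈ Z, h z = 0) :
    ∫⁻ x in Q, ‖h x‖ₑ ^ 2 ≤
      16 * ENNReal.ofReal d ^ 2 * ∫⁻ z in Q, ‖fderiv ℝ h z‖ₑ ^ 2 := by
  -- Restricting `y` to `Z`, where `h y = 0`, turns the double integral into a multiple of the `L²`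
  -- norm.
  have h1 : volume Z * ∫⁻ x in Q, ‖h x‖ₑ ^ 2 ≤ ∫⁻ x in Q, ∫⁻ y in Q, ‖h x - h y‖ₑ ^ 2 := by
    rw [← lintegral_const_mul _ (hh.continuous.enorm.measurable.pow_const 2)]
    refine lintegral_mono fun x => ?_
    calc volume Z * ‖h x‖ₑ ^ 2 = ∫⁻ _ in Z, ‖h x‖ₑ ^ 2 := by rw [setLIntegral_const, mul_comm]
      _ = ∫⁻ y in Z, ‖h x - h y‖ₑ ^ 2 :=
        setLIntegral_congr_fun hZ fun y hy => by simp [hzero y hy]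
      _ ≤ _ := lintegral_mono_set hZQ
  have h2 := h1.trans (lintegral_lintegral_sub_sq_le hh hQ hQm hd)
  refine (ENNReal.mul_le_mul_iff_right hQ0 hQt).1 ?_
  calc volume Q * ∫⁻ x in Q, ‖h x‖ₑ ^ 2 ≤ 2 * volume Z * ∫⁻ x in Q, ‖h x‖ₑ ^ 2 := by gcongr
    _ = 2 * (volume Z * ∫⁻ x in Q, ‖h x‖ₑ ^ 2) := by ring
    _ ≤ 2 * _ := mul_le_mul_right h2 _
    _ = _ := by ring

/-! ### Cubes and the sparse region -/

/-- The index of the cube of side `l` that contains `x`. -/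
noncomputable def cell (l : ℝ) (x : Space) : Fin 3 → ℤ := fun a => ⌊x a / l⌋

/-- The half-open cubes of side `l` that partition space. -/
def cube (l : ℝ) (m : Fin 3 → ℤ) : Set Space := {x | cell l x = m}

theorem mem_cube_iff {l : ℝ} (hl : 0 < l) {m : Fin 3 → ℤ} {x : Space} :
    x ∈ cube l m ↔ ∀ a, x a ∈ Set.Ico (m a * l) (m a * l + l) := by
  simp only [cube, cell, Set.mem_ofPred_eq, funext_iff, Int.floor_eq_iff, Set.mem_Ico]
  refine forall_congr' fun a => ?_
  rw [le_div_iff₀ hl, div_lt_iff₀ hl, add_mul, one_mul]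

theorem measurable_cell (l : ℝ) : Measurable (cell l) := by
  unfold cell
  fun_prop

theorem measurableSet_cube (l : ℝ) (m : Fin 3 → ℤ) : MeasurableSet (cube l m) :=
  measurable_cell l (measurableSet_singleton m)

theorem convex_cube {l : ℝ} (hl : 0 < l) (m : Fin 3 → ℤ) : Convex ℝ (cube l m) := by
  intro x hx y hy s t hs ht hst
  rw [mem_cube_iff hl] at *
  exact fun a => (convex_Ico (𝕜 := ℝ) _ _) (hx a) (hy a) hs ht hst

theorem dist_le_of_cell_eq {l : ℝ} (hl : 0 < l) {x y : Space} (h : cell l x = cell l y) :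
    dist x y ≤ 2 * l := by
  have hx := (mem_cube_iff (x := x) (m := cell l x) hl).1 rfl
  have hy := (mem_cube_iff (x := y) (m := cell l x) hl).1 h.symm
  have key : ∀ a, dist (x a) (y a) ^ 2 ≤ l ^ 2 := fun a => by
    rw [Real.dist_eq, sq_abs]
    have := hx a; have := hy a
    simp only [Set.mem_Ico] at *
    exact sq_le_sq' (by linarith) (by linarith)
  rw [EuclideanSpace.dist_eq, Fin.sum_univ_three]
  refine Real.sqrt_le_iff.2 ⟨by positivity, ?_⟩
  -- The diagonal has length `√3 l ≤ 2l`.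
  nlinarith [key 0, key 1, key 2, sq_nonneg l]

theorem volume_cube {l : ℝ} (hl : 0 < l) (m : Fin 3 → ℤ) :
    volume (cube l m) = ENNReal.ofReal (l ^ 3) := by
  have h : cube l m = (MeasurableEquiv.toLp 2 (Fin 3 → ℝ)).symm ⁻¹'
      (Set.univ.pi fun a => Set.Ico (m a * l) (m a * l + l)) := by
    ext x
    simp only [mem_cube_iff hl, Set.mem_preimage, Set.mem_univ_pi]
    rfl
  rw [h, (EuclideanSpace.volume_preserving_symm_measurableEquiv_toLp _).measure_preimage
    (MeasurableSet.univ_pi fun a => measurableSet_Ico).nullMeasurableSet, Real.volume_pi_Ico]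
  simp [ENNReal.ofReal_pow hl.le]

/-- The union of those cubes of side `l` of which `Ω` fills at most one half. -/
def sparseRegion (l : ℝ) (Ω : Set Space) : Set Space :=
  {x | 2 * volume (Ω ∩ cube l (cell l x)) ≤ volume (cube l (cell l x))}

theorem measurableSet_sparseRegion (l : ℝ) (Ω : Set Space) :
    MeasurableSet (sparseRegion l Ω) :=
  measurable_cell l (MeasurableSet.of_discrete
    (s := {m | 2 * volume (Ω ∩ cube l m) ≤ volume (cube l m)}))

/-- In each sparse cube `h` vanishes on the part outside `Ω`, at least half of the cube. The
diameter bound `2l` gives the Poincaré constant `16 (2l)² = 64 l²`, and the disjoint cubes are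
summed. -/
theorem setLIntegral_sparseRegion_sq_le {l : ℝ} (hl : 0 < l) {Ω : Set Space}
    (hΩ : MeasurableSet Ω) {h : Space → ℝ} (hh : ContDiff ℝ 1 h) (hzero : ∀ z ∉ Ω, h z = 0) :
    ∫⁻ x in sparseRegion l Ω, ‖h x‖ₑ ^ 2 ≤
      ENNReal.ofReal (64 * l ^ 2) * ∫⁻ z, ‖fderiv ℝ h z‖ₑ ^ 2 := by
  set S : Set (Fin 3 → ℤ) := {m | 2 * volume (Ω ∩ cube l m) ≤ volume (cube l m)} with hS
  have hU : sparseRegion l Ω = ⋃ m : S, cube l m := by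
    ext x
    simp only [sparseRegion, Set.mem_ofPred_eq, Set.mem_iUnion, Subtype.exists, hS, cube,
      exists_prop, exists_eq_right']
  have hdisj : Pairwise (Function.onFun Disjoint fun m : S => cube l m) := by
    intro m n hmn
    refine Set.disjoint_left.2 fun x hx hy => hmn (Subtype.ext ?_)
    exact hx.symm.trans hy
  rw [hU, lintegral_iUnion (fun m : S => measurableSet_cube l m) hdisj]
  have hC : 16 * ENNReal.ofReal (2 * l) ^ 2 = ENNReal.ofReal (64 * l ^ 2) := by
    rw [← ENNReal.ofReal_pow (by positivity),
      show (16 : ENNReal) = ENNReal.ofReal 16 by norm_num, ← ENNReal.ofReal_mul (by norm_num)]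
    congr 1
    ring
  calc ∑' m : S, ∫⁻ x in cube l m, ‖h x‖ₑ ^ 2
      ≤ ∑' m : S, ENNReal.ofReal (64 * l ^ 2) * ∫⁻ z in cube l m, ‖fderiv ℝ h z‖ₑ ^ 2 := by
        refine ENNReal.tsum_le_tsum fun m => ?_
        rw [← hC]
        have hQt : volume (cube l m) ≠ ⊤ := by rw [volume_cube hl]; finiteness
        refine setLIntegral_sq_le_of_vanishing (Z := cube l m \ Ω) hh (convex_cube hl m)
          (measurableSet_cube l m) (fun x hx y hy => dist_le_of_cell_eq hl (hx.trans hy.symm))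
          ?_ hQt ((measurableSet_cube l m).diff hΩ) Set.sdiff_subset ?_ (fun z hz => hzero z hz.2)
        · rw [volume_cube hl]; simp [hl]
        · have hm : 2 * volume (cube l m ∩ Ω) ≤ volume (cube l m) := by
            rw [Set.inter_comm]; exact m.2
          have h1 := measure_inter_add_sdiff (μ := volume) (cube l (m : Fin 3 → ℤ)) hΩ
          refine (ENNReal.add_le_add_iff_left hQt).1 ?_
          calc volume (cube l m) + volume (cube l m)
              = 2 * volume (cube l m ∩ Ω) + 2 * volume (cube l m \ Ω) := by
                rw [← mul_add, h1, two_mul]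
            _ ≤ _ := by gcongr
    _ = ENNReal.ofReal (64 * l ^ 2) *
          ∫⁻ z in ⋃ m : S, cube l m, ‖fderiv ℝ h z‖ₑ ^ 2 := by
        rw [ENNReal.tsum_mul_left, lintegral_iUnion (fun m : S => measurableSet_cube l m) hdisj]
    _ ≤ _ := by gcongr; exact Measure.restrict_le_self

/-! ### From one particle to configurations -/

theorem enorm_sq_le_sum_partial (L : Space →L[ℝ] ℝ) :
    ‖L‖ₑ ^ 2 ≤ ∑ a, ‖L (EuclideanSpace.single a (1 : ℝ))‖ₑ ^ 2 := by
  have hreal : ‖L‖ ^ 2 ≤ ∑ a, ‖L (EuclideanSpace.single a (1 : ℝ))‖ ^ 2 := by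
    rw [← Real.le_sqrt (norm_nonneg _) (by positivity)]
    refine L.opNorm_le_bound (Real.sqrt_nonneg _) fun v => ?_
    have hv : L v = ∑ a, L (EuclideanSpace.single a (1 : ℝ)) * v a := by
      conv_lhs => rw [← (EuclideanSpace.basisFun (Fin 3) ℝ).sum_repr v]
      simp [mul_comm]
    rw [hv, EuclideanSpace.norm_eq, ← Real.sqrt_mul (by positivity)]
    refine Real.abs_le_sqrt ?_
    simpa only [Real.norm_eq_abs, sq_abs] using Finset.sum_mul_sq_le_sq_mul_sq Finset.univ
      (fun a => L (EuclideanSpace.single a (1 : ℝ))) v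
  have := ENNReal.ofReal_le_ofReal hreal
  rw [ENNReal.ofReal_sum_of_nonneg (fun _ _ => by positivity)] at this
  simpa only [ENNReal.ofReal_pow (norm_nonneg _), ofReal_norm] using this

theorem lintegral_sparse_sq_le {N : ℕ} {l : ℝ} (hl : 0 < l) {Ω : Set Space}
    (hΩ : MeasurableSet Ω) {g : Config N → ℝ} (hg : ContDiff ℝ 1 g)
    (hzero : ∀ x ∉ domainPow Ω N, g x = 0) (i : Fin N) :
    ∫⁻ x in {x : Config N | x i ∈ sparseRegion l Ω}, ‖g x‖ₑ ^ 2 ≤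
      ENNReal.ofReal (64 * l ^ 2) * ∫⁻ x, ∑ a,
        ‖fderiv ℝ g x (Pi.single i (EuclideanSpace.single a (1 : ℝ)))‖ₑ ^ 2 := by
  have hS : MeasurableSet {x : Config N | x i ∈ sparseRegion l Ω} :=
    measurable_pi_apply i (measurableSet_sparseRegion l Ω)
  have hD : Measurable fun x => ∑ a,
      ‖fderiv ℝ g x (Pi.single i (EuclideanSpace.single a (1 : ℝ)))‖ₑ ^ 2 := by
    refine Finset.measurable_fun_sum _ fun a _ => ?_
    exact (((hg.continuous_fderiv one_ne_zero).clm_apply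
      continuous_const).enorm.measurable).pow_const 2
  rw [← lintegral_indicator hS, ← lintegral_const_mul _ hD]
  -- By Fubini it suffices to compare the integrals over `x i` with all other positions frozen.
  refine lintegral_le_of_lmarginal_le (μ := fun _ : Fin N => (volume : Measure Space)) {i}
    ((hg.continuous.enorm.measurable.pow_const 2).indicator hS) (hD.const_mul _) ?_
  intro x
  rw [lmarginal_singleton, lmarginal_singleton]
  set h : Space → ℝ := fun y => g (Function.update x i y) with hh
  have hder : ∀ y v, fderiv ℝ h y v = fderiv ℝ g (Function.update x i y) (Pi.single i v) := by
    intro y v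
    have h1 : HasFDerivAt h _ y := ((hg.differentiable one_ne_zero _).hasFDerivAt).comp y
      (hasFDerivAt_update (𝕜 := ℝ) x y)
    rw [h1.fderiv]
    simp only [ContinuousLinearMap.comp_apply]
    congr 1
    ext j
    rcases eq_or_ne j i with rfl | hj
    · simp
    · simp [hj]
  have hh1 : ContDiff ℝ 1 h := hg.comp (contDiff_update 1 x i)
  have key := setLIntegral_sparseRegion_sq_le hl hΩ hh1
    (fun z hz => hzero _ fun hmem => hz (by simpa using hmem i))
  calc _ = ∫⁻ y in sparseRegion l Ω, ‖h y‖ₑ ^ 2 := by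
        rw [← lintegral_indicator (measurableSet_sparseRegion l Ω)]
        refine lintegral_congr fun y => ?_
        have hmem : Function.update x i y ∈ {x : Config N | x i ∈ sparseRegion l Ω} ↔
            y ∈ sparseRegion l Ω := by
          rw [Set.mem_ofPred_eq, Function.update_self]
        by_cases hy : y ∈ sparseRegion l Ω
        · rw [Set.indicator_of_mem (hmem.2 hy), Set.indicator_of_mem hy]
        · rw [Set.indicator_of_notMem (mt hmem.1 hy), Set.indicator_of_notMem hy]
    _ ≤ _ := key
    _ ≤ ENNReal.ofReal (64 * l ^ 2) * ∫⁻ y, ∑ a,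
          ‖fderiv ℝ h y (EuclideanSpace.single a (1 : ℝ))‖ₑ ^ 2 := by
        gcongr with y
        exact enorm_sq_le_sum_partial _
    _ = _ := by
        rw [← lintegral_const_mul' _ _ ENNReal.ofReal_ne_top]
        simp only [hder]

/-! ### Diamagnetic inequality -/

/-- A smooth regularization of `|φ|` that vanishes where `φ` does. -/
noncomputable def smoothNorm {N : ℕ} (δ : ℝ) (φ : Config N → ℂ) (x : Config N) : ℝ :=
  √(‖φ x‖ ^ 2 + δ ^ 2) - δ

theorem contDiff_smoothNorm {N : ℕ} {δ : ℝ} (hδ : 0 < δ) {φ : Config N → ℂ}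
    (hφ : ContDiff ℝ 1 φ) : ContDiff ℝ 1 (smoothNorm δ φ) :=
  (((hφ.norm_sq ℝ).add contDiff_const).sqrt fun x => by positivity).sub contDiff_const

/-- The diamagnetic inequality, pointwise. -/
theorem abs_fderiv_smoothNorm_le {N : ℕ} {δ : ℝ} (hδ : 0 < δ) {φ : Config N → ℂ}
    (hφ : Differentiable ℝ φ) (A : Space → Space) (i : Fin N) (a : Fin 3) (x : Config N) :
    |fderiv ℝ (smoothNorm δ φ) x (Pi.single i (EuclideanSpace.single a (1 : ℝ)))| ≤
      ‖magneticMomentum A i a φ x‖ := by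
  set v : Config N := Pi.single i (EuclideanSpace.single a (1 : ℝ)) with hv
  have hpos : 0 < ‖φ x‖ ^ 2 + δ ^ 2 := by positivity
  have h1 := ((((hφ x).hasFDerivAt.norm_sq).add_const (δ ^ 2)).sqrt hpos.ne').sub_const δ
  have h2 : HasFDerivAt (smoothNorm δ φ) _ x := h1
  rw [h2.fderiv]
  have h3 : |inner ℝ (φ x) (fderiv ℝ φ x v)| ≤ ‖φ x‖ * ‖magneticMomentum A i a φ x‖ := by
    -- Since `A` is real, `i A |φ|²` has no real part, so the potential may be added to the
    -- derivative for free.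
    have h4 : inner ℝ (φ x) (fderiv ℝ φ x v) =
        (starRingEnd ℂ (φ x) * (Complex.I * magneticMomentum A i a φ x)).re := by
      rw [Complex.inner, magneticMomentum, ← hv]
      simp only [Complex.mul_re, Complex.mul_im, Complex.add_re, Complex.add_im, Complex.conj_re,
        Complex.conj_im, Complex.I_re, Complex.I_im, Complex.neg_re, Complex.neg_im,
        Complex.ofReal_re, Complex.ofReal_im]
      ring
    rw [h4]
    refine (Complex.abs_re_le_norm _).trans_eq ?_
    simp
  have h5 : ‖φ x‖ ≤ √(‖φ x‖ ^ 2 + δ ^ 2) :=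
    Real.le_sqrt_of_sq_le (by linarith [sq_nonneg δ])
  have h6 : 0 < √(‖φ x‖ ^ 2 + δ ^ 2) := Real.sqrt_pos.2 hpos
  have h7 : ((1 / (2 * √(‖φ x‖ ^ 2 + δ ^ 2))) •
      2 • (innerSL ℝ (φ x)).comp (fderiv ℝ φ x)) v =
      inner ℝ (φ x) (fderiv ℝ φ x v) / √(‖φ x‖ ^ 2 + δ ^ 2) := by
    simp
    field_simp
  rw [h7, abs_div, abs_of_pos h6, div_le_iff₀ h6, mul_comm]
  exact h3.trans (mul_le_mul_of_nonneg_right h5 (norm_nonneg _))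

theorem tendsto_smoothNorm {N : ℕ} (φ : Config N → ℂ) (x : Config N) :
    Tendsto (fun δ => smoothNorm δ φ x) (𝓝 0) (𝓝 ‖φ x‖) := by
  have : Continuous fun δ => smoothNorm δ φ x := by unfold smoothNorm; fun_prop
  simpa [smoothNorm] using this.tendsto 0

/-- As `|φ|` need not be differentiable, the inequality is applied to `smoothNorm δ φ`. The right
side is independent of `δ`, so Fatou's lemma lets `δ → 0`. -/
theorem setLIntegral_sparse_sq_le_magnetic {N : ℕ} {l : ℝ} (hl : 0 < l) {Ω : Set Space}
    (hΩ : MeasurableSet Ω) {φ : Config N → ℂ} (hφ : ContDiff ℝ 1 φ)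
    (hzero : ∀ x ∉ domainPow Ω N, φ x = 0) (A : Space → Space) (i : Fin N) :
    ∫⁻ x in {x : Config N | x i ∈ sparseRegion l Ω}, ‖φ x‖ₑ ^ 2 ≤
      ENNReal.ofReal (64 * l ^ 2) * ∫⁻ x, ∑ a, ‖magneticMomentum A i a φ x‖ₑ ^ 2 := by
  obtain ⟨u, -, hu0, hu⟩ := exists_seq_strictAnti_tendsto (0 : ℝ)
  have hlim : ∀ x, Tendsto (fun n => ‖smoothNorm (u n) φ x‖ₑ ^ 2) atTop (𝓝 (‖φ x‖ₑ ^ 2)) := by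
    intro x
    have h1 := ((tendsto_smoothNorm φ x).comp hu).enorm
    rw [enorm_norm] at h1
    exact ((ENNReal.continuous_pow 2).tendsto _).comp h1
  calc _ = ∫⁻ x in {x : Config N | x i ∈ sparseRegion l Ω},
          liminf (fun n => ‖smoothNorm (u n) φ x‖ₑ ^ 2) atTop :=
        lintegral_congr fun x => (hlim x).liminf_eq.symm
    _ ≤ liminf (fun n => ∫⁻ x in {x : Config N | x i ∈ sparseRegion l Ω},
          ‖smoothNorm (u n) φ x‖ₑ ^ 2) atTop :=
        lintegral_liminf_le fun n =>
          (contDiff_smoothNorm (hu0 n) hφ).continuous.enorm.measurable.pow_const 2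
    _ ≤ _ := by
        refine liminf_le_of_le (by isBoundedDefault) fun b hb => ?_
        obtain ⟨n, hn⟩ := hb.exists
        refine hn.trans ((lintegral_sparse_sq_le hl hΩ (contDiff_smoothNorm (hu0 n) hφ)
          (fun x hx => ?_) i).trans ?_)
        · simp [smoothNorm, hzero x hx, Real.sqrt_sq (hu0 n).le]
        · gcongr with x a
          rw [← ofReal_norm, ← ofReal_norm (magneticMomentum _ _ _ _ _)]
          exact ENNReal.ofReal_le_ofReal
            (abs_fderiv_smoothNorm_le (hu0 n) (hφ.differentiable one_ne_zero) A i a x)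

/-! ### Passage to the form domain -/

theorem enorm_sq_eq_lintegral {X : Type*} {mX : MeasurableSpace X} {μ : Measure X}
    (f : Lp ℂ 2 μ) : ‖f‖ₑ ^ 2 = ∫⁻ x, ‖f x‖ₑ ^ 2 ∂μ := by
  have h := eLpNorm_nnreal_pow_eq_lintegral (μ := μ) (f := f) (p := 2) two_ne_zero
  rw [Lp.enorm_def]
  simpa using h

theorem norm_sq_eq_integral {X : Type*} {mX : MeasurableSpace X} {μ : Measure X}
    (f : Lp ℂ 2 μ) : ‖f‖ ^ 2 = ∫ x, ‖f x‖ ^ 2 ∂μ := by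
  have h : (inner ℂ f f : ℂ) = ∫ x, ((‖f x‖ ^ 2 : ℝ) : ℂ) ∂μ := by
    rw [L2.inner_def]
    exact integral_congr_ae (.of_forall fun x => by simp [inner_self_eq_norm_sq_to_K])
  rw [integral_complex_ofReal, inner_self_eq_norm_sq_to_K] at h
  exact Complex.ofReal_injective (by rw [Complex.ofReal_pow]; exact h)

theorem measurableSet_domainPow {Ω : Set Space} (hΩ : MeasurableSet Ω) (N : ℕ) :
    MeasurableSet (domainPow Ω N) := by
  have : domainPow Ω N = Set.univ.pi fun _ => Ω := by ext; simp [domainPow]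
  rw [this]
  exact MeasurableSet.univ_pi fun _ => hΩ

theorem magneticMomentum_eq_zero {N : ℕ} (A : Space → Space) (i : Fin N) (a : Fin 3)
    {φ : Config N → ℂ} {x : Config N} (hx : x ∉ tsupport φ) : magneticMomentum A i a φ x = 0 := by
  simp [magneticMomentum, fderiv_of_notMem_tsupport (𝕜 := ℝ) hx, image_eq_zero_of_notMem_tsupport hx]

/-- Both sides are continuous in `(ψ, G)`, so the inequality defines a closed set and need only be
checked on the smooth graph. -/
theorem setIntegral_sparse_le_of_gradient {N : ℕ} {l : ℝ} (hl : 0 < l) {Ω : Set Space}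
    (hΩ : MeasurableSet Ω) {A : Space → Space} {ψ : HilbertN Ω N}
    {G : Fin N → Fin 3 → HilbertN Ω N} (h : HasDirichletMagneticGradient A Ω N ψ G) (i : Fin N) :
    ∫ x in domainPow Ω N, {x : Config N | x i ∈ sparseRegion l Ω}.indicator
        (fun x => ‖ψ x‖ ^ 2) x ≤ 64 * l ^ 2 * ∑ a, ‖G i a‖ ^ 2 := by
  set D := domainPow Ω N with hD
  have hDm : MeasurableSet D := measurableSet_domainPow hΩ N
  set S : Set (Config N) := {x | x i ∈ sparseRegion l Ω} with hS
  have hSm : MeasurableSet S := measurable_pi_apply i (measurableSet_sparseRegion l Ω)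
  let R := LpToLpRestrictCLM (Config N) ℂ ℂ (volume.restrict D) 2 S
  have hR : ∀ f : HilbertN Ω N, R f =ᵐ[(volume.restrict D).restrict S] f :=
    LpToLpRestrictCLM_coeFn ℂ S
  have hclosed : IsClosed {p : HilbertN Ω N × (Fin N → Fin 3 → HilbertN Ω N) |
      ‖R p.1‖ ^ 2 ≤ 64 * l ^ 2 * ∑ a, ‖p.2 i a‖ ^ 2} :=
    isClosed_le (by fun_prop) (by fun_prop)
  have hmem : (ψ, G) ∈ {p : HilbertN Ω N × (Fin N → Fin 3 → HilbertN Ω N) |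
      ‖R p.1‖ ^ 2 ≤ 64 * l ^ 2 * ∑ a, ‖p.2 i a‖ ^ 2} := by
    refine closure_minimal ?_ hclosed h
    rintro ⟨f, F⟩ ⟨φ, hφ, hf, hF⟩
    have hout : ∀ x ∉ D, x ∉ tsupport φ := fun x hx hx' => hx (hφ.support hx')
    have key := setLIntegral_sparse_sq_le_magnetic hl hΩ (hφ.smooth.of_le (by simp))
      (fun x hx => image_eq_zero_of_notMem_tsupport (hout x hx)) A i
    have h1 : ‖R f‖ₑ ^ 2 ≤ ENNReal.ofReal (64 * l ^ 2) * ∑ a, ‖F i a‖ₑ ^ 2 := by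
      calc ‖R f‖ₑ ^ 2 = ∫⁻ x in S, ‖φ x‖ₑ ^ 2 ∂(volume.restrict D) := by
            rw [enorm_sq_eq_lintegral]
            refine lintegral_congr_ae ?_
            filter_upwards [hR f, ae_restrict_of_ae hf] with x hx hx'
            rw [hx, hx']
        _ ≤ ∫⁻ x in S, ‖φ x‖ₑ ^ 2 := by
            refine lintegral_mono' (Measure.restrict_mono_measure Measure.restrict_le_self _) le_rfl
        _ ≤ _ := key
        _ = ENNReal.ofReal (64 * l ^ 2) *
              ∫⁻ x in D, ∑ a, ‖magneticMomentum A i a φ x‖ₑ ^ 2 := by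
            congr 1
            rw [← lintegral_indicator hDm]
            refine lintegral_congr fun x => ?_
            by_cases hx : x ∈ D
            · rw [Set.indicator_of_mem hx]
            · rw [Set.indicator_of_notMem hx]
              simp [magneticMomentum_eq_zero A i _ (hout x hx)]
        _ = ENNReal.ofReal (64 * l ^ 2) * ∫⁻ x in D, ∑ a, ‖F i a x‖ₑ ^ 2 := by
            congr 1
            refine lintegral_congr_ae ?_
            filter_upwards [ae_all_iff.2 fun a => hF i a] with x hx
            simp only [hx]
        _ = _ := by
            rw [lintegral_finsetSum' _ fun a _ =>
              (Lp.aestronglyMeasurable (F i a)).enorm.pow_const 2]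
            simp only [enorm_sq_eq_lintegral]
    simp only [← ofReal_norm, ← ENNReal.ofReal_pow (norm_nonneg _)] at h1
    rw [← ENNReal.ofReal_sum_of_nonneg (fun _ _ => by positivity),
      ← ENNReal.ofReal_mul (by positivity)] at h1
    exact (ENNReal.ofReal_le_ofReal_iff (by positivity)).1 h1
  have h2 : ∫ x in D, S.indicator (fun x => ‖ψ x‖ ^ 2) x = ‖R ψ‖ ^ 2 := by
    rw [integral_indicator hSm, norm_sq_eq_integral]
    refine integral_congr_ae ?_
    filter_upwards [hR ψ] with x hx
    rw [hx]
  rw [h2]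
  exact hmem

/-! ### Repulsion and counting of lonely particles -/

theorem maxRepulsion_nonneg {N : ℕ} (x : Config N) (i : Fin N) : 0 ≤ maxRepulsion x i :=
  Real.iSup_nonneg fun _ => by positivity

theorem potential_nonneg {N : ℕ} {ε : ℝ} (hε : 0 ≤ ε) (x : Config N) : 0 ≤ potential ε x :=
  Finset.sum_nonneg fun i _ => mul_nonneg hε (maxRepulsion_nonneg x i)

/-- Distinct positions matter because the convention `0⁻¹ = 0` makes the repulsion of coinciding
particles vanish. -/
theorem inv_le_maxRepulsion {N : ℕ} {l : ℝ} (hl : 0 < l) {x : Config N} {i k : Fin N}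
    (hki : k ≠ i) (hne : x i ≠ x k) (hcell : cell l (x i) = cell l (x k)) :
    (2 * l)⁻¹ ≤ maxRepulsion x i := by
  have h1 : (2 * l)⁻¹ ≤ ‖x i - x k‖⁻¹ := by
    have h2 := dist_le_of_cell_eq hl hcell
    rw [dist_eq_norm] at h2
    exact inv_anti₀ (norm_pos_iff.2 (sub_ne_zero.2 hne)) h2
  exact h1.trans (le_ciSup (f := fun k : {k : Fin N // k ≠ i} => ‖x i - x k.1‖⁻¹)
    (Set.finite_range _).bddAbove ⟨k, hki⟩)

/-- Particles alone in their cube, which `Ω` fills by more than one half, are few. -/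
theorem card_alone_mul_le {N : ℕ} {l : ℝ} (hl : 0 < l) {Ω : Set Space} (hΩ : MeasurableSet Ω)
    (hfin : volume Ω ≠ ⊤) (x : Config N) (T : Finset (Fin N))
    (hdense : ∀ i ∈ T, x i ∉ sparseRegion l Ω)
    (halone : ∀ i ∈ T, ∀ k, k ≠ i → cell l (x i) ≠ cell l (x k)) :
    T.card * l ^ 3 ≤ 2 * volume.real Ω := by
  have hdisj : (T : Set (Fin N)).PairwiseDisjoint fun i => Ω ∩ cube l (cell l (x i)) := by
    intro i hi k _ hik
    refine Set.disjoint_left.2 fun y hy hy' => halone i hi k hik.symm ?_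
    exact hy.2.symm.trans hy'.2
  have h1 : ∑ i ∈ T, volume (Ω ∩ cube l (cell l (x i))) ≤ volume Ω := by
    rw [← measure_biUnion_finset hdisj fun i _ => hΩ.inter (measurableSet_cube l _)]
    exact measure_mono (Set.iUnion₂_subset fun i _ => Set.inter_subset_left)
  have h2 : T.card * ENNReal.ofReal (l ^ 3) ≤ 2 * volume Ω := by
    calc T.card * ENNReal.ofReal (l ^ 3) = ∑ i ∈ T, volume (cube l (cell l (x i))) := by
          simp [volume_cube hl]
      _ ≤ ∑ i ∈ T, 2 * volume (Ω ∩ cube l (cell l (x i))) :=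
          Finset.sum_le_sum fun i hi => (not_le.1 (hdense i hi)).le
      _ ≤ _ := by rw [← Finset.mul_sum]; gcongr
  have h3 := ENNReal.toReal_mono (by finiteness) h2
  rwa [ENNReal.toReal_mul, ENNReal.toReal_mul, ENNReal.toReal_natCast, ENNReal.toReal_ofNat,
    ENNReal.toReal_ofReal (by positivity)] at h3

/-- Every particle outside `T` yields `κ`, through the indicator if its cube is sparse and through a
companion in its cube otherwise. The volume condition leaves at most `N/2` particles in `T`. -/
theorem le_sum_indicator_add_potential {N : ℕ} {l ε κ : ℝ} (hl : 0 < l) (hε : 0 < ε) (hκ : 0 ≤ κ)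
    (hκε : κ ≤ ε * (2 * l)⁻¹) {Ω : Set Space} (hΩ : MeasurableSet Ω) (hfin : volume Ω ≠ ⊤)
    (hvol : 4 * volume.real Ω ≤ N * l ^ 3) {x : Config N} (hx : Function.Injective x) :
    κ * (N / 2) ≤ ∑ i, {x : Config N | x i ∈ sparseRegion l Ω}.indicator (fun _ => κ) x
      + potential ε x := by
  classical
  set T : Finset (Fin N) := {i | x i ∉ sparseRegion l Ω ∧
    ∀ k, k ≠ i → cell l (x i) ≠ cell l (x k)} with hT
  have hcard := card_alone_mul_le hl hΩ hfin x T (fun i hi => (Finset.mem_filter.1 hi).2.1)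
    (fun i hi => (Finset.mem_filter.1 hi).2.2)
  have hcard' : (T.card : ℝ) ≤ N / 2 := by
    have : (T.card : ℝ) * l ^ 3 ≤ N / 2 * l ^ 3 := by linarith
    exact le_of_mul_le_mul_right this (by positivity)
  have hi : ∀ i, κ - (if i ∈ T then κ else 0) ≤
      {x : Config N | x i ∈ sparseRegion l Ω}.indicator (fun _ => κ) x
        + ε * maxRepulsion x i := by
    intro i
    have hW : 0 ≤ ε * maxRepulsion x i := mul_nonneg hε.le (maxRepulsion_nonneg x i)
    have hI : 0 ≤ {x : Config N | x i ∈ sparseRegion l Ω}.indicator (fun _ => κ) x :=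
      Set.indicator_nonneg (fun _ _ => hκ) _
    by_cases hiT : i ∈ T
    · rw [if_pos hiT]; linarith
    rw [if_neg hiT, sub_zero]
    by_cases hs : x i ∈ sparseRegion l Ω
    · rw [Set.indicator_of_mem (s := {x : Config N | x i ∈ sparseRegion l Ω}) hs]; linarith
    have : ∃ k, k ≠ i ∧ cell l (x i) = cell l (x k) := by
      by_contra! hc
      exact hiT (Finset.mem_filter.2 ⟨Finset.mem_univ _, hs, hc⟩)
    obtain ⟨k, hki, hcell⟩ := this
    have := mul_le_mul_of_nonneg_left
      (inv_le_maxRepulsion hl hki (fun h => hki (hx h).symm) hcell) hε.le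
    linarith
  calc κ * (N / 2) ≤ κ * (N - T.card) := by gcongr; linarith
    _ = ∑ i, (κ - (if i ∈ T then κ else 0)) := by
        rw [Finset.sum_sub_distrib, Finset.sum_ite_mem, Finset.univ_inter]
        simp [mul_sub, mul_comm]
    _ ≤ _ := (Finset.sum_le_sum fun i _ => hi i).trans_eq Finset.sum_add_distrib

/-- Each coincidence set `x i = x k` with `i ≠ k` is a proper linear subspace, hence null. -/
theorem ae_injective (N : ℕ) : ∀ᵐ x : Config N, Function.Injective x := by
  have h : ∀ i k : Fin N, i ≠ k → ∀ᵐ x : Config N, x i ≠ x k := by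
    intro i k hik
    let V : Submodule ℝ (Config N) := LinearMap.ker
      (LinearMap.proj (R := ℝ) (φ := fun _ : Fin N => Space) i - LinearMap.proj k)
    have hV : ∀ x : Config N, x ∈ V ↔ x i = x k := fun x => by
      simp [V, sub_eq_zero]
    have hne : V ≠ ⊤ := by
      intro htop
      have h1 : (Pi.single i (EuclideanSpace.single 0 (1 : ℝ)) : Config N) ∈ V := by
        rw [htop]; trivial
      rw [hV, Pi.single_eq_same, Pi.single_eq_of_ne hik.symm] at h1
      have := congrArg (fun v : Space => v 0) h1
      simp at this
    have h0 := Measure.addHaar_submodule (volume : Measure (Config N)) V hne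
    filter_upwards [measure_eq_zero_iff_ae_notMem.1 h0] with x hx hxe
    exact hx ((hV x).2 hxe)
  have h2 : ∀ᵐ x : Config N, ∀ i k : Fin N, i ≠ k → x i ≠ x k :=
    ae_all_iff.2 fun i => ae_all_iff.2 fun k => by
      by_cases hik : i = k
      · exact .of_forall fun x hne => absurd hik hne
      · filter_upwards [h i k hik] with x hx _ using hx
  filter_upwards [h2] with x hx i k hik
  by_contra hne
  exact hx i k hne hik

/-! ### Energy bound and choice of the scale -/

theorem energyForm_self_re {ε : ℝ} {Ω : Set Space} {N : ℕ}
    {ψ : HilbertN Ω N} {G : Fin N → Fin 3 → HilbertN Ω N} :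
    (energyForm ε Ω N ψ G ψ G).re = ∑ i, ∑ a, ‖G i a‖ ^ 2
      + ∫ x in domainPow Ω N, potential ε x * ‖ψ x‖ ^ 2 := by
  have h1 : ∫ x in domainPow Ω N, (potential ε x : ℂ) * inner ℂ (ψ x) (ψ x) =
      ((∫ x in domainPow Ω N, potential ε x * ‖ψ x‖ ^ 2 : ℝ) : ℂ) := by
    rw [← integral_complex_ofReal]
    refine integral_congr_ae (.of_forall fun x => ?_)
    simp [inner_self_eq_norm_sq_to_K]
  rw [energyForm, h1, Complex.add_re, Complex.ofReal_re, Complex.re_sum]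
  congr 1
  refine Finset.sum_congr rfl fun i _ => ?_
  rw [Complex.re_sum]
  exact Finset.sum_congr rfl fun a _ => inner_self_eq_norm_sq (𝕜 := ℂ) (G i a)

/-- The pointwise bound is integrated against `|ψ|²`. The condition `κ · 64 l² ≤ 1` lets the
gradient term of each particle pay for its indicator. -/
theorem le_energyForm_self {N : ℕ} {l ε κ : ℝ} (hl : 0 < l) (hε : 0 < ε) (hκ : 0 ≤ κ)
    (hκε : κ ≤ ε * (2 * l)⁻¹) (hκl : κ * (64 * l ^ 2) ≤ 1) {Ω : Set Space}
    (hΩ : MeasurableSet Ω) (hfin : volume Ω ≠ ⊤) (hvol : 4 * volume.real Ω ≤ N * l ^ 3)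
    {A : Space → Space} {ψ : HilbertN Ω N} {G : Fin N → Fin 3 → HilbertN Ω N}
    (h : InFormDomain ε A Ω N ψ G) :
    κ * (N / 2) * ‖ψ‖ ^ 2 ≤ (energyForm ε Ω N ψ G ψ G).re := by
  have hint : Integrable (fun x => ‖ψ x‖ ^ 2) (volume.restrict (domainPow Ω N)) :=
    (Lp.memLp ψ).integrable_norm_pow two_ne_zero
  have hS : ∀ i : Fin N, MeasurableSet {x : Config N | x i ∈ sparseRegion l Ω} := fun i =>
    measurable_pi_apply i (measurableSet_sparseRegion l Ω)
  have hintS : ∀ i : Fin N, Integrable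
      (fun x => κ * {x : Config N | x i ∈ sparseRegion l Ω}.indicator (fun x => ‖ψ x‖ ^ 2) x)
      (volume.restrict (domainPow Ω N)) := fun i => (hint.indicator (hS i)).const_mul κ
  rw [energyForm_self_re]
  calc κ * (N / 2) * ‖ψ‖ ^ 2
      = ∫ x in domainPow Ω N, κ * (N / 2) * ‖ψ x‖ ^ 2 := by
        rw [integral_const_mul, norm_sq_eq_integral]
    _ ≤ ∫ x in domainPow Ω N, (∑ i, κ * {x : Config N | x i ∈ sparseRegion l Ω}.indicator
          (fun x => ‖ψ x‖ ^ 2) x + potential ε x * ‖ψ x‖ ^ 2) := by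
        refine integral_mono_ae (hint.const_mul _)
          ((integrable_finsetSum _ fun i _ => hintS i).add h.finite_potential) ?_
        filter_upwards [ae_restrict_of_ae (ae_injective N)] with x hx
        have h1 := mul_le_mul_of_nonneg_right
          (le_sum_indicator_add_potential hl hε hκ hκε hΩ hfin hvol hx) (sq_nonneg ‖ψ x‖)
        refine h1.trans_eq ?_
        rw [add_mul, Finset.sum_mul]
        congr 1
        refine Finset.sum_congr rfl fun i _ => ?_
        by_cases hs : x ∈ {x : Config N | x i ∈ sparseRegion l Ω}
        · rw [Set.indicator_of_mem hs, Set.indicator_of_mem hs]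
        · rw [Set.indicator_of_notMem hs, Set.indicator_of_notMem hs, zero_mul, mul_zero]
    _ = ∑ i, κ * (∫ x in domainPow Ω N, {x : Config N | x i ∈ sparseRegion l Ω}.indicator
          (fun x => ‖ψ x‖ ^ 2) x) + ∫ x in domainPow Ω N, potential ε x * ‖ψ x‖ ^ 2 := by
        rw [integral_add (integrable_finsetSum _ fun i _ => hintS i) h.finite_potential,
          integral_finsetSum _ fun i _ => hintS i]
        simp only [integral_const_mul]
    _ ≤ _ := by
        gcongr with i
        have h2 := mul_le_mul_of_nonneg_left
          (setIntegral_sparse_le_of_gradient hl hΩ h.gradient i) hκ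
        have h3 : 0 ≤ ∑ a, ‖G i a‖ ^ 2 := by positivity
        calc _ ≤ _ := h2
          _ = κ * (64 * l ^ 2) * ∑ a, ‖G i a‖ ^ 2 := by ring
          _ ≤ _ := mul_le_of_le_one_left h3 hκl

theorem min_cube_self_le_sq {t : ℝ} (ht : 0 ≤ t) : min (t ^ 3) t ≤ t ^ 2 := by
  rcases le_total t 1 with h | h
  · exact (min_le_left _ _).trans (pow_le_pow_of_le_one ht h (by norm_num))
  · exact (min_le_right _ _).trans (le_self_pow₀ h two_ne_zero)

theorem formDomain_bound {ε : ℝ} (hε : 0 < ε) {N : ℕ} {A : Space → Space} {Ω : Set Space}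
    (hΩ : MeasurableSet Ω) (hfin : volume Ω ≠ ⊤) {ψ : HilbertN Ω N}
    {G : Fin N → Fin 3 → HilbertN Ω N} (h : InFormDomain ε A Ω N ψ G) :
    min (1 / 256) (ε / 4) / 2 * N *
        min ((N : ℝ) / volume.real Ω) (((N : ℝ) / volume.real Ω) ^ (1 / 3 : ℝ)) * ‖ψ‖ ^ 2
      ≤ (energyForm ε Ω N ψ G ψ G).re := by
  set ρ : ℝ := (N : ℝ) / volume.real Ω with hρ
  have hρ0 : 0 ≤ ρ := by positivity
  set t : ℝ := ρ ^ (1 / 3 : ℝ) with ht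
  have ht3 : t ^ 3 = ρ := by
    rw [ht, ← Real.rpow_natCast, ← Real.rpow_mul hρ0]; norm_num
  rw [← ht3]
  -- The case `t = 0` covers `N = 0` and, since division by zero gives zero, `|Ω| = 0`. The claim is
  -- then nonnegativity of the energy.
  rcases (Real.rpow_nonneg hρ0 (1 / 3 : ℝ)).eq_or_lt' with h0 | hpos
  · rw [← ht] at h0
    rw [h0, energyForm_self_re]
    simp only [ne_eq, OfNat.ofNat_ne_zero, not_false_eq_true, zero_pow, min_self, mul_zero,
      zero_mul]
    have : 0 ≤ ∫ x in domainPow Ω N, potential ε x * ‖ψ x‖ ^ 2 :=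
      integral_nonneg fun x => mul_nonneg (potential_nonneg hε.le x) (sq_nonneg _)
    positivity
  rw [← ht] at hpos
  set κ : ℝ := min (1 / 256) (ε / 4) * min (t ^ 3) t with hκ
  have hc : 0 < min (1 / 256) (ε / 4) := by positivity
  have hm : 0 < min (t ^ 3) t := by positivity
  have hΩ0 : volume.real Ω ≠ 0 := by
    intro h0
    rw [h0, div_zero] at hρ
    rw [hρ] at ht3
    exact (pow_pos hpos 3).ne' ht3
  -- With `l = 2/t` one has `N l³ = 8|Ω|`, more than the `4|Ω|` required. The constants come from
  -- `64 l² = 256/t²` and `ε/(2l) = εt/4`.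
  have hmain := le_energyForm_self (l := 2 / t) (κ := κ) (by positivity) hε (by positivity) ?_ ?_
    hΩ hfin ?_ h
  · refine le_trans (le_of_eq ?_) hmain
    rw [hκ]; ring
  · calc κ ≤ ε / 4 * t :=
          mul_le_mul (min_le_right _ _) (min_le_right _ _) hm.le (by positivity)
      _ = _ := by field_simp; norm_num
  · calc κ * (64 * (2 / t) ^ 2) ≤ 1 / 256 * t ^ 2 * (64 * (2 / t) ^ 2) := by
          gcongr
          exact mul_le_mul (min_le_left _ _) (min_cube_self_le_sq hpos.le) hm.le (by norm_num)
      _ = 1 := by field_simp; norm_num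
  · have h1 : (N : ℝ) = t ^ 3 * volume.real Ω := by rw [ht3, hρ]; field_simp
    have h2 : (N : ℝ) * (2 / t) ^ 3 = 8 * volume.real Ω := by rw [h1]; field_simp; norm_num
    rw [h2]
    have : 0 ≤ volume.real Ω := measureReal_nonneg
    linarith

end RepellingParticles

open RepellingParticles in
/-- For every `ε > 0` there is `c > 0`, depending only on `ε`, such that
`∑_i (T(A)_{x_i} + ε max_{k ≠ i} |x_i - x_k|⁻¹) ≥ c N min {N/|Ω|, (N/|Ω|)^{1/3}}` on `L²(Ω^N)`:
first as quadratic forms on the whole form domain, then on the domain of the operator. -/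
theorem mainTheorem9 (ε : ℝ) (hε : 0 < ε) :
    ∃ c : ℝ, 0 < c ∧
      ∀ (N : ℕ) (A : Space → Space) (Ω : Set Space),
        LocallyL2 A → DivFree A → IsOpen Ω → Bornology.IsBounded Ω →
        (∀ (ψ : HilbertN Ω N) (G : Fin N → Fin 3 → HilbertN Ω N),
          InFormDomain ε A Ω N ψ G →
            c * N * min ((N : ℝ) / volume.real Ω) (((N : ℝ) / volume.real Ω) ^ (1 / 3 : ℝ))
                * ‖ψ‖ ^ 2
              ≤ (energyForm ε Ω N ψ G ψ G).re) ∧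
        (∀ ψ f : HilbertN Ω N, IsHamiltonianValue ε A Ω N ψ f →
            c * N * min ((N : ℝ) / volume.real Ω) (((N : ℝ) / volume.real Ω) ^ (1 / 3 : ℝ))
                * ‖ψ‖ ^ 2
              ≤ (inner ℂ ψ f).re) := by
  -- The final factor `1/2` is the guaranteed fraction of particles that pay.
  refine ⟨min (1 / 256) (ε / 4) / 2, by positivity, fun N A Ω _ _ hΩ hb => ⟨?_, ?_⟩⟩
  · exact fun ψ G h => formDomain_bound hε hΩ.measurableSet hb.measure_lt_top.ne h
  · rintro ψ f ⟨G, hG, hf⟩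
    rw [← hf ψ G hG]
    exact formDomain_bound hε hΩ.measurableSet hb.measure_lt_top.ne hG
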